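/- All graphs are finite and simple. For a graph $\Gamma$ with vertex set $V$ and $v\in V$, let $N[v]$ be the closed neighborhood of $v$ (that is, $v$ together with its neighbors). The RA matrix $C_\Gamma$ is the integer matrix with columns indexed by $V$ whose rows are the $0/1$ indicator vectors of the sets $N[v]$ ($v\in V$) and $N[u]\cap N[v]$ ($u,v\in V$). The nullity of an integer matrix is the rank over $\mathbb Z$ of its right kernel, and its elementary divisors are the diagonal entries of its Smith normal form over $\mathbb Z$; they are nontrivial if they are different from $1$. For $m\ge 1$ the crown graph $\mathrm{Cr}(2m)$ has vertices $1,\dots,m,1',\dots,m'$, and its edges are the pairs $\{i,j'\}$ with $i\ne j$. For $N\ge 2$ the binary graph $\mathrm{Bg}(N)$ has as vertices the numbers $0,\dots,N-1$ and $\lceil\log_2 N\rceil$ bit positions; any two numbers are adjacent, any two bit positions are adjacent, and a number is adjacent to a bit position exactly when its binary expansion has a $1$ there. Let $z(N)$ be the nullity of $C_{\mathrm{Bg}(N)}$. The pyramid over a graph is obtained by adding one vertex adjacent to all its vertices. Theorem. Let $n\ge 0$, let $d_1\mid d_2\mid\cdots\mid d_n$ be integers with all $d_i\ge 2$, and let $r\ge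 0$ be an integer. Then there is a connected graph $\Gamma$ such that $C_\Gamma$ has nullity $r$ and the nontrivial nonzero elementary divisors of $C_\Gamma$ are precisely $d_1,\dots,d_n$ (with multiplicity). Moreover, there is an $N\ge 2$ with $z(N)=r$, and if $n\ge 1$ then, for every such $N$, the pyramid over the disjoint union of $\mathrm{Cr}(2d_1+4),\dots,\mathrm{Cr}(2d_n+4)$ and $\mathrm{Bg}(N)$ is such a graph $\Gamma$; if $n\ge 1$ and $r=0$, so is the pyramid over the disjoint union of $\mathrm{Cr}(2d_1+4),\dots,\mathrm{Cr}(2d_n+4)$ alone. -/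

import Mathlib

namespace RAGraph

/-! ### The RA matrix of a graph -/

/-- The closed neighborhood `N[v] = N(v) ∪ {v}`. -/
def closedNbhd {V : Type} (Γ : SimpleGraph V) (v : V) : Set V :=
  insert v (Γ.neighborSet v)

/-- The bit vector of a set `S` of vertices: the sum of the `e_v` for `v ∈ S`. -/
noncomputable def bitVector {V : Type} (S : Set V) : V → ℤ :=
  S.indicator 1

/-- The RA matrix `C_Γ`: its columns are indexed by the vertices, and its rows are the bit vectors
of `N[v]` for all vertices `v` and of `N[u] ∩ N[v]` for all pairs of vertices `(u, v)`. -/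
noncomputable def raMatrix {V : Type} (Γ : SimpleGraph V) : Matrix (V ⊕ V × V) V ℤ :=
  Matrix.of fun row => match row with
    | Sum.inl v => bitVector (closedNbhd Γ v)
    | Sum.inr (u, v) => bitVector (closedNbhd Γ u ∩ closedNbhd Γ v)

/-! ### Nullity and elementary divisors of an integer matrix -/

/-- The rank of the right kernel of an integer matrix. -/
noncomputable def nullity {m n : Type} [Fintype n] (A : Matrix m n ℤ) : ℕ :=
  Module.finrank ℤ (LinearMap.ker A.mulVecLin)

/-- `L` is the list of all elementary divisors of `A` (ones and zeros included), i.e. the diagonal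
of a Smith normal form of `A`: each entry of `L` divides the next one, and `P * A * Q` is, for some
matrices `P`, `Q` that are invertible over `ℤ`, and after an enumeration of its rows and columns,
the (rectangular) diagonal matrix with diagonal `L`. -/
def HasElementaryDivisors {m n : Type} [Fintype m] [Fintype n] [DecidableEq m] [DecidableEq n]
    (A : Matrix m n ℤ) (L : List ℕ) : Prop :=
  L.length = min (Fintype.card m) (Fintype.card n) ∧ L.IsChain (· ∣ ·) ∧
    ∃ (P : GL m ℤ) (Q : GL n ℤ) (e : m ≃ Fin (Fintype.card m)) (f : n ≃ Fin (Fintype.card n)),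
      ∀ (i : m) (j : n), ((P : Matrix m m ℤ) * A * (Q : Matrix n n ℤ)) i j =
        if (e i : ℕ) = (f j : ℕ) then ((L.getD (e i : ℕ) 0 : ℕ) : ℤ) else 0

/-- The elementary divisors of `A` other than `0` and `1` are precisely the entries of `L`, in
this order and with these multiplicities. -/
def HasNontrivialNonzeroElementaryDivisors {m n : Type} [Fintype m] [Fintype n] [DecidableEq m]
    [DecidableEq n] (A : Matrix m n ℤ) (L : List ℕ) : Prop :=
  ∃ L' : List ℕ, HasElementaryDivisors A L' ∧ L'.filter (fun x => x ≠ 0 ∧ x ≠ 1) = L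

/-! ### The graphs of the construction -/

/-- The crown graph `Cr(2m)` on the `2m` vertices `1, …, m, 1', …, m'`, in which `i` and `j'` are
adjacent precisely when `i ≠ j`, and there are no other edges. -/
def crownGraph (m : ℕ) : SimpleGraph (Fin m ⊕ Fin m) where
  Adj x y := match x, y with
    | Sum.inl i, Sum.inr j => i ≠ j
    | Sum.inr i, Sum.inl j => i ≠ j
    | _, _ => False
  symm := ⟨by rintro (i | i) (j | j) h <;> first | exact h | exact Ne.symm h⟩
  loopless := ⟨by rintro (i | i) h <;> exact h⟩

/-- The binary graph `Bg(N)`: a clique on the numbers `0, …, N - 1` and a clique on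
`⌈log₂ N⌉` bit positions, where a number is adjacent to a bit position precisely when its binary
expansion has a `1` there. -/
def binaryGraph (N : ℕ) : SimpleGraph (Fin N ⊕ Fin (Nat.clog 2 N)) where
  Adj x y := match x, y with
    | Sum.inl k, Sum.inl l => k ≠ l
    | Sum.inr i, Sum.inr j => i ≠ j
    | Sum.inl k, Sum.inr i => (k : ℕ).testBit (i : ℕ) = true
    | Sum.inr i, Sum.inl k => (k : ℕ).testBit (i : ℕ) = true
  symm := ⟨by rintro (i | i) (j | j) h <;> first | exact h | exact Ne.symm h⟩
  loopless := ⟨by rintro (i | i) h <;> exact h rfl⟩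

/-- `z(N)`, the nullity of the RA matrix of the binary graph `Bg(N)`. -/
noncomputable def binaryNullity (N : ℕ) : ℕ :=
  nullity (raMatrix (binaryGraph N))

/-- The disjoint union of a family of graphs. -/
def disjointUnion {ι : Type} {V : ι → Type} (G : ∀ i, SimpleGraph (V i)) :
    SimpleGraph (Σ i, V i) where
  Adj x y := ∃ (i : ι) (a b : V i), x = ⟨i, a⟩ ∧ y = ⟨i, b⟩ ∧ (G i).Adj a b
  symm := ⟨by rintro _ _ ⟨i, a, b, rfl, rfl, h⟩; exact ⟨i, b, a, rfl, rfl, h.symm⟩⟩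
  loopless := ⟨by
    rintro _ ⟨i, a, b, rfl, hb, h⟩
    cases hb
    exact (G i).irrefl h⟩

/-- The join of two graphs: their disjoint union, with every vertex of the first joined to every
vertex of the second. -/
def join {V W : Type} (G : SimpleGraph V) (H : SimpleGraph W) : SimpleGraph (V ⊕ W) where
  Adj x y := match x, y with
    | Sum.inl a, Sum.inl b => G.Adj a b
    | Sum.inr a, Sum.inr b => H.Adj a b
    | _, _ => True
  symm := ⟨by
    rintro (a | a) (b | b) h
    · exact SimpleGraph.Adj.symm (G := G) h
    · trivial
    · trivial
    · exact SimpleGraph.Adj.symm (G := H) h⟩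
  loopless := ⟨by
    rintro (a | a) h
    · exact G.irrefl h
    · exact H.irrefl h⟩

/-- The pyramid over a graph: its join with the one-vertex graph `K₁`. -/
def pyramid {V : Type} (G : SimpleGraph V) : SimpleGraph (Unit ⊕ V) :=
  join (⊥ : SimpleGraph Unit) G

end RAGraph

/-!
Nullity and elementary divisors of `C_Γ` depend only on the lattice `L(Γ)` spanned by its rows, and
are read off once `L(Γ)` is described by divisibility conditions on some coordinates of a vector.

For the crown graph `Cr(2(d + 2))` with `d ≥ 1` the traces `N[i] ∩ N[j']` with `i ≠ j` are the sums
`e_i + e_j'`, and a third index also yields `e_i + e_i'`. Modulo these sums `N[i]` becomes `-d e_i`;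
hence `L` consists of the vectors whose two side sums agree modulo `d`.

For `Bg(N)` the unit vectors of the bit positions lie in `L`. Let `S(k)` be the set of the numbers
that have a digit `1` wherever `k` has one. On the numbers, `L` is spanned by the indicator vectors
of the `S(k)` for which `k < N` has at most two digits `1`. As the indicator vectors of the `S(k)`
for all `k < N` form a unitriangular matrix, the nullity `z(N)` counts the `k < N` with at least
three digits `1`: it is unbounded and increases in steps of at most one.

Disjoint unions turn `L` into a direct sum. A pyramid only adds the unit vector of the apex,
provided that `L` contains the all-ones vector (the trace of the apex on the base) and that two
closed neighborhoods of the base are disjoint (the apex is the intersection of their cones).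
-/

namespace RAGraph

open Matrix Module

section Lattice

variable {R F M N ι : Type*} [CommRing R]

lemma exists_linearEquiv_ker_prod [AddCommGroup M] [Module R M] [AddCommGroup N] [Module R N]
    [Projective R N] (φ : M →ₗ[R] N) (hφ : Function.Surjective φ) :
    ∃ e : M ≃ₗ[R] LinearMap.ker φ × N, ∀ x, (e x).2 = φ x := by
  obtain ⟨s, hs⟩ := projective_lifting_property φ LinearMap.id hφ
  obtain ⟨e, -, he⟩ := Function.Exact.splitSurjectiveEquiv (LinearMap.exact_subtype_ker_map φ)
    (LinearMap.ker φ).injective_subtype ⟨s, hs⟩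
  exact ⟨e, fun x => (LinearMap.congr_fun he x).symm⟩

lemma exists_linearEquiv_of_range_eq [IsDomain R] [IsPrincipalIdealRing R]
    [AddCommGroup F] [Module R F] [Free R F] [Module.Finite R F]
    [AddCommGroup M] [Module R M] [IsTorsionFree R M]
    (α β : F →ₗ[R] M) (h : LinearMap.range α = LinearMap.range β) :
    ∃ E : F ≃ₗ[R] F, ∀ x, α (E x) = β x := by
  obtain ⟨e, he⟩ := exists_linearEquiv_ker_prod α.rangeRestrict α.surjective_rangeRestrict
  obtain ⟨e', he'⟩ := exists_linearEquiv_ker_prod β.rangeRestrict β.surjective_rangeRestrict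
  let J := LinearEquiv.ofEq _ _ h.symm
  have hker : finrank R (LinearMap.ker β.rangeRestrict) =
      finrank R (LinearMap.ker α.rangeRestrict) := by
    have hprod := e'.finrank_eq.symm.trans e.finrank_eq
    rw [finrank_prod, finrank_prod, J.finrank_eq] at hprod
    exact Nat.add_right_cancel hprod
  let K := LinearEquiv.ofFinrankEq _ _ hker
  refine ⟨e'.trans ((K.prodCongr J).trans e.symm), fun x => ?_⟩
  calc α (e.symm (K.prodCongr J (e' x)))
      = (e (e.symm (K.prodCongr J (e' x)))).2 := by rw [he]; rfl
    _ = (e' x).2 := by rw [LinearEquiv.apply_symm_apply]; rfl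
    _ = β x := by rw [he']; rfl

end Lattice

section Matrix

variable {R m n : Type*} [CommRing R]

lemma range_vecMulLinear_eq_span [Fintype m] (A : Matrix m n R) :
    LinearMap.range A.vecMulLinear = Submodule.span R (Set.range A.row) := by
  rw [← mulVecLin_transpose, range_mulVecLin]
  rfl

lemma exists_GL_vecMul_eq [Fintype m] [DecidableEq m] (E : (m → R) ≃ₗ[R] (m → R)) :
    ∃ P : GL m R, ∀ x, x ᵥ* (P : Matrix m m R) = E x := by
  refine ⟨⟨E.toLinearMap.toMatrixRight', E.symm.toLinearMap.toMatrixRight', ?_, ?_⟩, fun x => ?_⟩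
  · rw [← LinearMap.toMatrixRight'_comp, E.symm_comp, LinearMap.toMatrixRight'_id]
  · rw [← LinearMap.toMatrixRight'_comp, E.comp_symm, LinearMap.toMatrixRight'_id]
  · exact LinearMap.congr_fun (LinearMap.toMatrixRight'.symm_apply_apply E.toLinearMap) x

lemma exists_GL_mul_eq_of_span_row_eq [IsDomain R] [IsPrincipalIdealRing R] [Fintype m]
    [DecidableEq m] (A B : Matrix m n R)
    (h : Submodule.span R (Set.range A.row) = Submodule.span R (Set.range B.row)) :
    ∃ P : GL m R, (P : Matrix m m R) * A = B := by
  rw [← range_vecMulLinear_eq_span, ← range_vecMulLinear_eq_span] at h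
  obtain ⟨E, hE⟩ := exists_linearEquiv_of_range_eq _ _ h
  obtain ⟨P, hP⟩ := exists_GL_vecMul_eq E
  refine ⟨P, Matrix.ext_of_single_vecMul fun i => ?_⟩
  rw [← vecMul_vecMul, hP]
  exact hE _

lemma span_row_mul [Finite m] [Fintype n] {l : Type*} (A : Matrix m n R) (B : Matrix n l R) :
    Submodule.span R (Set.range (A * B).row) =
      (Submodule.span R (Set.range A.row)).map B.vecMulLinear := by
  have := Fintype.ofFinite m
  rw [← range_vecMulLinear_eq_span, ← range_vecMulLinear_eq_span, ← LinearMap.range_comp]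
  exact congrArg _ (LinearMap.ext fun x => (vecMul_vecMul x A B).symm)

lemma mem_span_row_iff_forall_dvd [DecidableEq m] [Finite n] {D : Matrix m n R} {b : n → R}
    {r : n → m} (hr : Function.Injective r) (hD : ∀ i j, D i j = if i = r j then b j else 0)
    {x : n → R} : x ∈ Submodule.span R (Set.range D.row) ↔ ∀ j, b j ∣ x j := by
  classical
  have := Fintype.ofFinite n
  constructor
  · intro hx
    have hle : Submodule.span R (Set.range D.row) ≤
        Submodule.pi Set.univ fun j => Ideal.span {b j} := by
      rw [Submodule.span_le]
      rintro _ ⟨i, rfl⟩ j -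
      rw [SetLike.mem_coe, Ideal.mem_span_singleton, row_apply, hD]
      split <;> simp
    exact fun j => Ideal.mem_span_singleton.1 (hle hx j trivial)
  · intro hx
    rw [← Finset.univ_sum_single x]
    refine Submodule.sum_mem _ fun j _ => ?_
    obtain ⟨c, hc⟩ := hx j
    have hrow : Pi.single j (x j) = c • D.row (r j) := by
      ext k
      rcases eq_or_ne j k with rfl | hjk
      · simp [hD, hc, mul_comm]
      · simp [hD, hr.ne hjk, hjk.symm]
    exact hrow ▸ Submodule.smul_mem _ _ (Submodule.subset_span ⟨_, rfl⟩)

end Matrix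

section DiagonalForm

variable {m n : Type} {ι κ : Type*}

/-- In suitable coordinates, the sublattice `L` of `M` is the set of vectors whose `i`-th coordinate
is divisible by `a i`, for all `i`. The coordinates `φ` need not be complete: as `ℤ ^ ι` is free,
`φ` splits, and `L` contains its kernel, so the coordinates left out only contribute elementary
divisors `1`. -/
def HasDiagonalForm {M : Type*} [AddCommGroup M] (L : Submodule ℤ M) (a : ι → ℕ) : Prop :=
  ∃ φ : M →ₗ[ℤ] (ι → ℤ), Function.Surjective φ ∧ ∀ x, x ∈ L ↔ ∀ i, (a i : ℤ) ∣ φ x i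

lemma hasElementaryDivisors_of_linearEquiv [Fintype m] [Fintype n] [DecidableEq m] [DecidableEq n]
    {A : Matrix m n ℤ} (hmn : Fintype.card n ≤ Fintype.card m) {L : List ℕ}
    (hL : L.IsChain (· ∣ ·)) (hlen : L.length = Fintype.card n) (f : n ≃ Fin (Fintype.card n))
    (Q : (n → ℤ) ≃ₗ[ℤ] (n → ℤ))
    (hQ : ∀ x, x ∈ Submodule.span ℤ (Set.range A.row) ↔
      ∀ j, ((L.getD (f j) 0 : ℕ) : ℤ) ∣ Q x j) :
    HasElementaryDivisors A L := by
  let e := Fintype.equivFin m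
  let D : Matrix m n ℤ := Matrix.of fun i j =>
    if (e i : ℕ) = (f j : ℕ) then ((L.getD (e i) 0 : ℕ) : ℤ) else 0
  let r : n → m := fun j => e.symm (Fin.castLE hmn (f j))
  have hr : Function.Injective r :=
    e.symm.injective.comp ((Fin.castLE_injective hmn).comp f.injective)
  have hD : ∀ i j, D i j = if i = r j then ((L.getD (f j) 0 : ℕ) : ℤ) else 0 := fun i j => by
    have hij : (e i : ℕ) = f j ↔ i = r j := by
      rw [Equiv.eq_symm_apply, Fin.ext_iff, Fin.val_castLE]
    simp only [D, of_apply, ← hij]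
    split_ifs with h
    · rw [h]
    · rfl
  obtain ⟨Q', hQ'⟩ := exists_GL_vecMul_eq Q
  have hspan : Submodule.span ℤ (Set.range (A * (Q' : Matrix n n ℤ)).row) =
      Submodule.span ℤ (Set.range D.row) := by
    ext y
    rw [span_row_mul, mem_span_row_iff_forall_dvd hr hD, Submodule.mem_map]
    simp only [vecMulLinear_apply, hQ', hQ]
    exact ⟨fun ⟨_, hx, hxy⟩ => hxy ▸ hx, fun hy => ⟨Q.symm y, by simpa using hy, by simp⟩⟩
  obtain ⟨P, hP⟩ := exists_GL_mul_eq_of_span_row_eq _ _ hspan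
  refine ⟨by rw [hlen, min_eq_right hmn], hL, P, Q', e, f, fun i j => ?_⟩
  rw [Matrix.mul_assoc, hP]
  rfl

lemma HasDiagonalForm.exists_hasElementaryDivisors [Fintype m] [Fintype n] [DecidableEq m]
    [DecidableEq n] {A : Matrix m n ℤ} {k : ℕ} {a : Fin k → ℕ}
    (hA : HasDiagonalForm (Submodule.span ℤ (Set.range A.row)) a)
    (hmn : Fintype.card n ≤ Fintype.card m) (ha : (List.ofFn a).IsChain (· ∣ ·)) :
    ∃ p, HasElementaryDivisors A (List.replicate p 1 ++ List.ofFn a) := by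
  obtain ⟨φ, hφ, hmem⟩ := hA
  obtain ⟨e, he⟩ := exists_linearEquiv_ker_prod φ hφ
  let p := finrank ℤ (LinearMap.ker φ)
  have hcard : Fintype.card n = p + k := by
    simpa only [finrank_prod, finrank_fintype_fun_eq_card, Fintype.card_fin] using e.finrank_eq
  let f := Fintype.equivFin n
  let σ : n ≃ Fin p ⊕ Fin k := f.trans ((finCongr hcard).trans finSumFinEquiv.symm)
  let Q : (n → ℤ) ≃ₗ[ℤ] (n → ℤ) :=
    e.trans (((finBasis ℤ (LinearMap.ker φ)).equivFun.prodCongr (LinearEquiv.refl ℤ _)).trans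
      ((LinearEquiv.sumArrowLequivProdArrow _ _ ℤ ℤ).symm.trans (LinearEquiv.funCongrLeft ℤ ℤ σ)))
  have hQ : ∀ x i, Q x (σ.symm (Sum.inr i)) = φ x i := fun x i => by
    simp [Q, LinearEquiv.funCongrLeft, LinearMap.funLeft, he]
  have hL : ∀ s, (List.replicate p 1 ++ List.ofFn a).getD (f (σ.symm s)) 0 =
      Sum.elim (fun _ => 1) a s := by
    rintro (i | i)
    · rw [List.getD_append _ _ _ _ (by simp [σ])]
      simp [σ]
    · simp [σ]
  refine ⟨p, hasElementaryDivisors_of_linearEquiv hmn ?_ (by simp [hcard]) f Q fun x => ?_⟩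
  · rw [List.isChain_append]
    exact ⟨by simp [List.isChain_iff_pairwise, List.pairwise_replicate], ha, fun x hx y _ => by
      rw [List.eq_of_mem_replicate (List.mem_of_mem_getLast? hx)]
      exact one_dvd y⟩
  · rw [hmem, ← σ.symm.forall_congr_right, Sum.forall]
    simp only [hL, Sum.elim_inl, Sum.elim_inr, hQ, Nat.cast_one, one_dvd, implies_true, true_and]

lemma HasDiagonalForm.reindex {M : Type*} [AddCommGroup M] {L : Submodule ℤ M} {a : ι → ℕ}
    (hL : HasDiagonalForm L a) (e : κ ≃ ι) : HasDiagonalForm L (a ∘ e) := by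
  obtain ⟨φ, hφ, hmem⟩ := hL
  refine ⟨LinearMap.funLeft ℤ ℤ e ∘ₗ φ,
    (LinearMap.funLeft_surjective_of_injective ℤ ℤ e e.injective).comp hφ, fun x => ?_⟩
  rw [hmem, ← e.forall_congr_right]
  rfl

lemma HasDiagonalForm.emptySum {M : Type*} [AddCommGroup M] {L : Submodule ℤ M} [IsEmpty ι]
    {b : κ → ℕ} (hL : HasDiagonalForm L b) (a : ι → ℕ) : HasDiagonalForm L (Sum.elim a b) := by
  convert hL.reindex (Equiv.emptySum ι κ) using 1
  ext (i | j)
  exacts [isEmptyElim i, rfl]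

lemma HasDiagonalForm.sumEmpty {M : Type*} [AddCommGroup M] {L : Submodule ℤ M} [IsEmpty κ]
    {a : ι → ℕ} (hL : HasDiagonalForm L a) (b : κ → ℕ) : HasDiagonalForm L (Sum.elim a b) := by
  convert hL.reindex (Equiv.sumEmpty ι κ) using 1
  ext (i | j)
  exacts [rfl, isEmptyElim j]

lemma exists_ne_zero_forall_dvd_mul {R ι : Type*} [CommRing R] [IsDomain R] [Finite ι]
    {a x : ι → R} (hx : ∀ i, a i = 0 → x i = 0) : ∃ c, c ≠ 0 ∧ ∀ i, a i ∣ c * x i := by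
  classical
  have := Fintype.ofFinite ι
  refine ⟨∏ i : {i // a i ≠ 0}, a i, Finset.prod_ne_zero_iff.2 fun i _ => i.2, fun i => ?_⟩
  by_cases hi : a i = 0
  · rw [hx i hi, mul_zero]
    exact dvd_zero _
  · exact (Finset.dvd_prod_of_mem (fun i : {i // a i ≠ 0} => a i)
      (Finset.mem_univ ⟨i, hi⟩)).mul_right _

lemma HasDiagonalForm.finrank_dualAnnihilator {M : Type*} [AddCommGroup M] [Finite ι]
    {L : Submodule ℤ M} {a : ι → ℕ} (hL : HasDiagonalForm L a) :
    finrank ℤ L.dualAnnihilator = Nat.card {i // a i = 0} := by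
  obtain ⟨φ, hφ, hmem⟩ := hL
  let ψ : M →ₗ[ℤ] ({i // a i = 0} → ℤ) := LinearMap.funLeft ℤ ℤ Subtype.val ∘ₗ φ
  have hψ : Function.Surjective ψ :=
    (LinearMap.funLeft_surjective_of_injective ℤ ℤ _ Subtype.val_injective).comp hφ
  have hann : L.dualAnnihilator = (LinearMap.ker ψ).dualAnnihilator := by
    refine le_antisymm (fun f hf => ?_) (Submodule.dualAnnihilator_anti fun x hx => ?_)
    · rw [Submodule.mem_dualAnnihilator] at hf ⊢
      intro x hx
      obtain ⟨c, hc, hdvd⟩ := exists_ne_zero_forall_dvd_mul (a := fun i => (a i : ℤ)) (x := φ x)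
        fun i hi => congrFun hx ⟨i, Nat.cast_eq_zero.1 hi⟩
      have hfx : f (c • x) = 0 := hf _ ((hmem _).2 (by simpa using hdvd))
      exact (mul_eq_zero.1 ((map_smul f c x).symm.trans hfx)).resolve_left hc
    · refine funext fun i => ?_
      have hi := (hmem x).1 hx i
      rwa [i.2, Nat.cast_zero, zero_dvd_iff] at hi
  rw [hann, ← LinearMap.range_dualMap_eq_dualAnnihilator_ker_of_surjective ψ hψ,
    LinearMap.finrank_range_of_inj (LinearMap.dualMap_injective_of_surjective hψ)]
  classical
  have := Fintype.ofFinite ι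
  rw [finrank_linearMap, finrank_fintype_fun_eq_card, finrank_self, mul_one,
    Nat.card_eq_fintype_card]

lemma nullity_eq_finrank_dualAnnihilator [Fintype n] (A : Matrix m n ℤ) :
    nullity A = finrank ℤ (Submodule.span ℤ (Set.range A.row)).dualAnnihilator := by
  classical
  have hker : (LinearMap.ker A.mulVecLin).map (dotProductEquiv ℤ n).toLinearMap =
      (Submodule.span ℤ (Set.range A.row)).dualAnnihilator := by
    ext f
    obtain ⟨y, rfl⟩ := (dotProductEquiv ℤ n).surjective f
    calc dotProductEquiv ℤ n y ∈ (LinearMap.ker A.mulVecLin).map (dotProductEquiv ℤ n).toLinearMap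
        ↔ ∀ i, A.row i ⬝ᵥ y = 0 := by
          rw [Submodule.mem_map_equiv, LinearEquiv.symm_apply_apply,
            LinearMap.mem_ker]
          exact funext_iff
      _ ↔ Set.range A.row ⊆ LinearMap.ker (dotProductEquiv ℤ n y) := by
          simp [Set.range_subset_iff, dotProduct_comm y]
      _ ↔ dotProductEquiv ℤ n y ∈ (Submodule.span ℤ (Set.range A.row)).dualAnnihilator := by
          rw [← Submodule.span_le, Submodule.mem_dualAnnihilator]
          rfl
  rw [nullity, ← hker, LinearEquiv.finrank_map_eq]

lemma HasDiagonalForm.nullity_eq [Fintype n] [Finite ι] [Finite κ] {A : Matrix m n ℤ}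
    {a : ι → ℕ}
    (hA : HasDiagonalForm (Submodule.span ℤ (Set.range A.row)) (Sum.elim a fun _ : κ => 0))
    (ha : ∀ i, a i ≠ 0) : nullity A = Nat.card κ := by
  rw [nullity_eq_finrank_dualAnnihilator, hA.finrank_dualAnnihilator]
  refine (Nat.card_congr (Equiv.ofBijective (fun j => ⟨Sum.inr j, rfl⟩) ⟨fun _ _ h => ?_, ?_⟩)).symm
  · exact Sum.inr_injective (Subtype.ext_iff.1 h)
  · rintro ⟨i | j, h⟩
    · exact absurd h (ha i)
    · exact ⟨j, rfl⟩

lemma HasDiagonalForm.hasNontrivialNonzeroElementaryDivisors [Fintype m] [Fintype n]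
    [DecidableEq m] [DecidableEq n] [Finite κ] {A : Matrix m n ℤ} {k : ℕ} {d : Fin k → ℕ}
    (hA : HasDiagonalForm (Submodule.span ℤ (Set.range A.row)) (Sum.elim d fun _ : κ => 0))
    (hmn : Fintype.card n ≤ Fintype.card m) (hd : ∀ i, 2 ≤ d i)
    (hdvd : ∀ i j, i ≤ j → d i ∣ d j) :
    HasNontrivialNonzeroElementaryDivisors A (List.ofFn d) := by
  let q := Nat.card κ
  have hform := hA.reindex (finSumFinEquiv.symm.trans
    ((Equiv.refl (Fin k)).sumCongr (Finite.equivFin κ).symm))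
  have happend : Sum.elim d (fun _ : κ => 0) ∘ (finSumFinEquiv.symm.trans
      ((Equiv.refl (Fin k)).sumCongr (Finite.equivFin κ).symm)) =
      Fin.append d fun _ : Fin q => 0 := by
    ext i
    obtain ⟨i | i, rfl⟩ := finSumFinEquiv.surjective i <;> simp [q]
  rw [happend] at hform
  have hlist : List.ofFn (Fin.append d fun _ : Fin q => 0) = List.ofFn d ++ List.replicate q 0 := by
    rw [List.ofFn_fin_append, List.ofFn_const]
  obtain ⟨p, hp⟩ := hform.exists_hasElementaryDivisors hmn <| by
    simp only [hlist, List.isChain_iff_pairwise, List.pairwise_append, List.pairwise_ofFn]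
    refine ⟨fun i j hij => hdvd i j hij.le, by simp [List.pairwise_replicate], fun x _ y hy => ?_⟩
    rw [List.eq_of_mem_replicate hy]
    exact dvd_zero x
  refine ⟨_, hp, ?_⟩
  have hfilter : (List.ofFn d).filter (fun x => x ≠ 0 ∧ x ≠ 1) = List.ofFn d := by
    refine List.filter_eq_self.2 fun x hx => ?_
    obtain ⟨i, rfl⟩ := (List.mem_ofFn' d x).1 hx
    have := hd i
    simpa using ⟨by lia, by lia⟩
  rw [hlist, List.filter_append, List.filter_append, hfilter]
  simp

lemma HasDiagonalForm.comap {M N : Type*} [AddCommGroup M] [AddCommGroup N] {L : Submodule ℤ N}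
    {a : ι → ℕ} (hL : HasDiagonalForm L a) {f : M →ₗ[ℤ] N} (hf : Function.Surjective f) :
    HasDiagonalForm (L.comap f) a := by
  obtain ⟨φ, hφ, hmem⟩ := hL
  exact ⟨φ ∘ₗ f, hφ.comp hf, fun x => hmem (f x)⟩

lemma HasDiagonalForm.inf_comap {M N P : Type*} [AddCommGroup M] [AddCommGroup N] [AddCommGroup P]
    {L : Submodule ℤ M} {K : Submodule ℤ N} {a : ι → ℕ} {b : κ → ℕ} (hL : HasDiagonalForm L a)
    (hK : HasDiagonalForm K b) {f : P →ₗ[ℤ] M} {g : P →ₗ[ℤ] N}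
    (hfg : Function.Surjective (f.prod g)) :
    HasDiagonalForm (L.comap f ⊓ K.comap g) (Sum.elim a b) := by
  obtain ⟨φ, hφ, hLmem⟩ := hL
  obtain ⟨ψ, hψ, hKmem⟩ := hK
  refine ⟨(LinearEquiv.sumArrowLequivProdArrow ι κ ℤ ℤ).symm.toLinearMap ∘ₗ φ.prodMap ψ ∘ₗ f.prod g,
    (LinearEquiv.sumArrowLequivProdArrow ι κ ℤ ℤ).symm.surjective.comp
      ((hφ.prodMap hψ).comp hfg), fun x => ?_⟩
  rw [Submodule.mem_inf, Submodule.mem_comap, Submodule.mem_comap, hLmem, hKmem, Sum.forall]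
  rfl

lemma HasDiagonalForm.iInf_comap {P : Type*} {M : ι → Type*} {κ : ι → Type*} [AddCommGroup P]
    [∀ i, AddCommGroup (M i)] {L : ∀ i, Submodule ℤ (M i)} {a : ∀ i, κ i → ℕ}
    (hL : ∀ i, HasDiagonalForm (L i) (a i)) {f : ∀ i, P →ₗ[ℤ] M i}
    (hf : Function.Surjective (LinearMap.pi f)) :
    HasDiagonalForm (⨅ i, (L i).comap (f i)) fun k : Σ i, κ i => a k.1 k.2 := by
  choose φ hφ hmem using hL
  let curry := LinearEquiv.piCurry ℤ fun (i : ι) (_ : κ i) => ℤ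
  refine ⟨curry.symm.toLinearMap ∘ₗ LinearMap.piMap φ ∘ₗ LinearMap.pi f,
    curry.symm.surjective.comp ((Function.Surjective.piMap hφ).comp hf), fun x => ?_⟩
  simp only [Submodule.mem_iInf, Submodule.mem_comap, hmem, Sigma.forall]
  rfl

lemma hasDiagonalForm_span_basis_image {M : Type*} [AddCommGroup M] [Finite ι]
    (b : Basis ι ℤ M) (s : Set ι) :
    HasDiagonalForm (Submodule.span ℤ (b '' s)) fun _ : ↥sᶜ => 0 := by
  refine ⟨LinearMap.funLeft ℤ ℤ Subtype.val ∘ₗ b.equivFun.toLinearMap,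
    (LinearMap.funLeft_surjective_of_injective ℤ ℤ _ Subtype.val_injective).comp
      b.equivFun.surjective, fun x => ?_⟩
  simp only [b.mem_span_image, Set.subset_def, SetLike.mem_coe, Finsupp.mem_support_iff,
    Subtype.forall, Nat.cast_zero, zero_dvd_iff, Set.mem_compl_iff]
  exact forall_congr' fun i => not_imp_comm

end DiagonalForm

section RowLattice

variable {V W : Type}

lemma mem_closedNbhd {Γ : SimpleGraph V} {u v : V} : u ∈ closedNbhd Γ v ↔ u = v ∨ Γ.Adj v u :=
  Iff.rfl

lemma mem_closedNbhd_comm {Γ : SimpleGraph V} {u v : V} :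
    u ∈ closedNbhd Γ v ↔ v ∈ closedNbhd Γ u := by
  rw [mem_closedNbhd, mem_closedNbhd, eq_comm, Γ.adj_comm]

open Classical in
lemma bitVector_apply (S : Set V) (v : V) : bitVector S v = if v ∈ S then 1 else 0 :=
  Set.indicator_apply S 1 v

lemma funLeft_bitVector (f : V → W) (S : Set W) :
    LinearMap.funLeft ℤ ℤ f (bitVector S) = bitVector (f ⁻¹' S) :=
  rfl

/-- The lattice spanned by the rows of the RA matrix; it determines both the nullity and the
elementary divisors. -/
noncomputable def rowLattice (Γ : SimpleGraph V) : Submodule ℤ (V → ℤ) :=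
  Submodule.span ℤ (Set.range (raMatrix Γ).row)

lemma bitVector_inter_mem_rowLattice (Γ : SimpleGraph V) (u v : V) :
    bitVector (closedNbhd Γ u ∩ closedNbhd Γ v) ∈ rowLattice Γ :=
  Submodule.subset_span ⟨Sum.inr (u, v), rfl⟩

lemma bitVector_closedNbhd_mem_rowLattice (Γ : SimpleGraph V) (v : V) :
    bitVector (closedNbhd Γ v) ∈ rowLattice Γ :=
  Submodule.subset_span ⟨Sum.inl v, rfl⟩

lemma rowLattice_le {Γ : SimpleGraph V} {L : Submodule ℤ (V → ℤ)}
    (h : ∀ u v, bitVector (closedNbhd Γ u ∩ closedNbhd Γ v) ∈ L) : rowLattice Γ ≤ L := by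
  refine Submodule.span_le.2 ?_
  rintro _ ⟨v | ⟨u, v⟩, rfl⟩
  · have hv := h v v
    rwa [Set.inter_self] at hv
  · exact h u v

lemma rowLattice_eq_span (Γ : SimpleGraph V) : rowLattice Γ = Submodule.span ℤ
    (Set.range fun p : V × V => bitVector (closedNbhd Γ p.1 ∩ closedNbhd Γ p.2)) := by
  refine le_antisymm (rowLattice_le fun u v => Submodule.subset_span ⟨(u, v), rfl⟩)
    (Submodule.span_le.2 ?_)
  rintro _ ⟨⟨u, v⟩, rfl⟩
  exact bitVector_inter_mem_rowLattice Γ u v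

lemma ker_funLeft_le {R : Type*} [CommRing R] [Finite W] {f : V → W} {L : Submodule R (W → R)}
    [DecidableEq W] (hL : ∀ w ∉ Set.range f, Pi.single w 1 ∈ L) :
    LinearMap.ker (LinearMap.funLeft R R f) ≤ L := by
  have := Fintype.ofFinite W
  intro x hx
  rw [pi_eq_sum_univ' x]
  refine Submodule.sum_mem _ fun w _ => ?_
  by_cases hw : w ∈ Set.range f
  · obtain ⟨v, rfl⟩ := hw
    have hxv : x (f v) = 0 := congrFun hx v
    rw [hxv, zero_smul]
    exact L.zero_mem
  · exact L.smul_mem _ (hL w hw)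

lemma comap_funLeft_rowLattice [Finite W] [DecidableEq W] {Γ : SimpleGraph W} {f : V → W}
    (hΓ : ∀ w ∉ Set.range f, Pi.single w 1 ∈ rowLattice Γ) :
    rowLattice Γ =
      (Submodule.span ℤ (Set.range fun p : W × W =>
        bitVector (f ⁻¹' (closedNbhd Γ p.1 ∩ closedNbhd Γ p.2)))).comap
        (LinearMap.funLeft ℤ ℤ f) := by
  have hmap : (rowLattice Γ).map (LinearMap.funLeft ℤ ℤ f) = Submodule.span ℤ (Set.range
      fun p : W × W => bitVector (f ⁻¹' (closedNbhd Γ p.1 ∩ closedNbhd Γ p.2))) := by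
    rw [rowLattice_eq_span, Submodule.map_span, ← Set.range_comp]
    rfl
  rw [← hmap]
  have hker : LinearMap.ker (LinearMap.funLeft ℤ ℤ f) ≤ rowLattice Γ := ker_funLeft_le (R := ℤ) hΓ
  exact (Submodule.comap_map_eq_self hker).symm

end RowLattice

section Constructions

variable {V W : Type}

lemma rowLattice_le_comap_funLeft {G : SimpleGraph V} {H : SimpleGraph W} {f : V → W}
    (hf : Function.Injective f) (hN : ∀ v, closedNbhd H (f v) = f '' closedNbhd G v) :
    rowLattice H ≤ (rowLattice G).comap (LinearMap.funLeft ℤ ℤ f) := by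
  have hpre : ∀ w, f ⁻¹' closedNbhd H w = ∅ ∨ ∃ v, f ⁻¹' closedNbhd H w = closedNbhd G v := by
    refine fun w => (Set.eq_empty_or_nonempty _).imp_right ?_
    rintro ⟨a, ha⟩
    rw [Set.mem_preimage, mem_closedNbhd_comm, hN] at ha
    obtain ⟨v, -, rfl⟩ := ha
    exact ⟨v, by rw [hN, hf.preimage_image]⟩
  refine rowLattice_le fun u v => ?_
  rw [Submodule.mem_comap, funLeft_bitVector, Set.preimage_inter]
  have hempty : bitVector (∅ : Set V) ∈ rowLattice G := by
    rw [bitVector, Set.indicator_empty]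
    exact zero_mem _
  rcases hpre u with hu | ⟨u', hu⟩
  · rwa [hu, Set.empty_inter]
  rcases hpre v with hv | ⟨v', hv⟩
  · rwa [hv, Set.inter_empty]
  · rw [hu, hv]
    exact bitVector_inter_mem_rowLattice G u' v'

lemma extendByZero_bitVector {f : V → W} (hf : Function.Injective f) (S : Set V) :
    Function.ExtendByZero.linearMap ℤ f (bitVector S) = bitVector (f '' S) := by
  ext w
  by_cases hw : w ∈ Set.range f
  · obtain ⟨v, rfl⟩ := hw
    refine (hf.extend_apply (bitVector S) 0 v).trans ?_
    rw [bitVector_apply, bitVector_apply, hf.mem_set_image]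
  · rw [bitVector_apply, if_neg fun h => hw (Set.image_subset_range f S h)]
    exact Function.extend_apply' _ _ _ hw

lemma rowLattice_le_comap_extendByZero {G : SimpleGraph V} {H : SimpleGraph W} {f : V → W}
    (hf : Function.Injective f) (hN : ∀ v, closedNbhd H (f v) = f '' closedNbhd G v) :
    rowLattice G ≤ (rowLattice H).comap (Function.ExtendByZero.linearMap ℤ f) := by
  refine rowLattice_le fun u v => ?_
  rw [Submodule.mem_comap, extendByZero_bitVector hf, Set.image_inter hf, ← hN, ← hN]
  exact bitVector_inter_mem_rowLattice H (f u) (f v)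

lemma closedNbhd_sum_inl (G : SimpleGraph V) (H : SimpleGraph W) (v : V) :
    closedNbhd (G ⊕g H) (Sum.inl v) = Sum.inl '' closedNbhd G v := by
  ext (w | w) <;> simp [mem_closedNbhd]

lemma closedNbhd_sum_inr (G : SimpleGraph V) (H : SimpleGraph W) (w : W) :
    closedNbhd (G ⊕g H) (Sum.inr w) = Sum.inr '' closedNbhd H w := by
  ext (v | v) <;> simp [mem_closedNbhd]

lemma closedNbhd_disjointUnion {ι : Type} {V : ι → Type} (G : ∀ i, SimpleGraph (V i)) (i : ι)
    (v : V i) : closedNbhd (disjointUnion G) ⟨i, v⟩ = Sigma.mk i '' closedNbhd (G i) v := by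
  ext ⟨j, w⟩
  constructor
  · rintro (h | ⟨k, a, b, hva, hwb, hab⟩)
    · obtain ⟨rfl, h⟩ := Sigma.mk.inj h
      exact ⟨w, Or.inl (eq_of_heq h), rfl⟩
    · obtain ⟨rfl, rfl⟩ := Sigma.mk.inj hva
      cases hwb
      exact ⟨b, Or.inr hab, rfl⟩
  · rintro ⟨b, rfl | hb, h⟩
    · exact Or.inl h.symm
    · exact Or.inr ⟨i, v, b, rfl, h.symm, hb⟩

lemma rowLattice_sum (G : SimpleGraph V) (H : SimpleGraph W) :
    rowLattice (G ⊕g H) = (rowLattice G).comap (LinearMap.funLeft ℤ ℤ Sum.inl) ⊓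
      (rowLattice H).comap (LinearMap.funLeft ℤ ℤ Sum.inr) := by
  refine le_antisymm (le_inf
    (rowLattice_le_comap_funLeft Sum.inl_injective (closedNbhd_sum_inl G H))
    (rowLattice_le_comap_funLeft Sum.inr_injective (closedNbhd_sum_inr G H))) ?_
  rintro x ⟨hG, hH⟩
  have hx : x = Function.ExtendByZero.linearMap ℤ Sum.inl (x ∘ Sum.inl) +
      Function.ExtendByZero.linearMap ℤ Sum.inr (x ∘ Sum.inr) := by
    ext (v | w)
    · simp [Sum.inl_injective.extend_apply]
    · simp [Sum.inr_injective.extend_apply]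
  rw [hx]
  exact add_mem (rowLattice_le_comap_extendByZero Sum.inl_injective (closedNbhd_sum_inl G H) hG)
    (rowLattice_le_comap_extendByZero Sum.inr_injective (closedNbhd_sum_inr G H) hH)

lemma rowLattice_disjointUnion {ι : Type} [Finite ι] {V : ι → Type} (G : ∀ i, SimpleGraph (V i)) :
    rowLattice (disjointUnion G) =
      ⨅ i, (rowLattice (G i)).comap (LinearMap.funLeft ℤ ℤ (Sigma.mk i)) := by
  have := Fintype.ofFinite ι
  refine le_antisymm (le_iInf fun i =>
    rowLattice_le_comap_funLeft sigma_mk_injective (closedNbhd_disjointUnion G i)) fun x hx => ?_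
  have hx' : x = ∑ i, Function.ExtendByZero.linearMap ℤ (Sigma.mk i) (x ∘ Sigma.mk i) := by
    ext ⟨i, v⟩
    rw [Finset.sum_apply, Finset.sum_eq_single i]
    · exact (sigma_mk_injective.extend_apply (x ∘ Sigma.mk i) 0 v).symm
    · rintro j - hji
      refine Function.extend_apply' _ _ _ ?_
      rintro ⟨w, hw⟩
      exact hji (congrArg Sigma.fst hw)
    · simp
  rw [hx']
  exact sum_mem fun i _ => rowLattice_le_comap_extendByZero sigma_mk_injective
    (closedNbhd_disjointUnion G i) (Submodule.mem_iInf _ |>.1 hx i)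

lemma preimage_inr_closedNbhd_pyramid_inl (G : SimpleGraph V) (u : Unit) :
    Sum.inr ⁻¹' closedNbhd (pyramid G) (Sum.inl u) = Set.univ := by
  ext; simp [mem_closedNbhd, pyramid, join]

lemma preimage_inr_closedNbhd_pyramid_inr (G : SimpleGraph V) (v : V) :
    Sum.inr ⁻¹' closedNbhd (pyramid G) (Sum.inr v) = closedNbhd G v := by
  ext; simp [mem_closedNbhd, pyramid, join]

lemma inl_mem_closedNbhd_pyramid (G : SimpleGraph V) (u : Unit) (x : Unit ⊕ V) :
    Sum.inl u ∈ closedNbhd (pyramid G) x := by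
  rcases x with x | x <;> simp [mem_closedNbhd, pyramid, join]

lemma rowLattice_pyramid [Finite V] {G : SimpleGraph V} (hone : 1 ∈ rowLattice G) {a b : V}
    (hab : Disjoint (closedNbhd G a) (closedNbhd G b)) :
    rowLattice (pyramid G) = (rowLattice G).comap (LinearMap.funLeft ℤ ℤ Sum.inr) := by
  classical
  have hapex : ∀ w ∉ Set.range (Sum.inr : V → Unit ⊕ V),
      Pi.single w 1 ∈ rowLattice (pyramid G) := by
    rintro (_ | w) hw
    · convert bitVector_inter_mem_rowLattice (pyramid G) (Sum.inr a) (Sum.inr b) using 1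
      ext (_ | v)
      · simp [bitVector_apply, inl_mem_closedNbhd_pyramid]
      · have hv : v ∉ closedNbhd G a ∩ closedNbhd G b := by simp [hab.inter_eq]
        rw [← preimage_inr_closedNbhd_pyramid_inr G a, ← preimage_inr_closedNbhd_pyramid_inr G b,
          ← Set.preimage_inter, Set.mem_preimage] at hv
        rw [bitVector_apply, if_neg hv, Pi.single_eq_of_ne Sum.inr_ne_inl]
    · exact absurd ⟨w, rfl⟩ hw
  rw [comap_funLeft_rowLattice hapex]
  congr 1
  refine le_antisymm (Submodule.span_le.2 ?_) (rowLattice_le fun u v => ?_)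
  · rintro _ ⟨⟨u | u, v | v⟩, rfl⟩ <;>
    simp only [Set.preimage_inter, preimage_inr_closedNbhd_pyramid_inl,
      preimage_inr_closedNbhd_pyramid_inr, Set.univ_inter, Set.inter_univ]
    · rwa [bitVector, Set.indicator_univ]
    · exact bitVector_closedNbhd_mem_rowLattice G v
    · exact bitVector_closedNbhd_mem_rowLattice G u
    · exact bitVector_inter_mem_rowLattice G u v
  · refine Submodule.subset_span ⟨(Sum.inr u, Sum.inr v), ?_⟩
    simp only [Set.preimage_inter, preimage_inr_closedNbhd_pyramid_inr]

lemma pyramid_connected (G : SimpleGraph V) : (pyramid G).Connected := by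
  refine (SimpleGraph.connected_iff_exists_forall_reachable _).2 ⟨Sum.inl (), ?_⟩
  rintro (_ | v)
  · rfl
  · exact SimpleGraph.Adj.reachable (by simp [pyramid, join])

end Constructions

section Crown

lemma mem_closedNbhd_crownGraph {m : ℕ} {i j : Fin m} :
    (Sum.inl j ∈ closedNbhd (crownGraph m) (Sum.inl i) ↔ j = i) ∧
    (Sum.inr j ∈ closedNbhd (crownGraph m) (Sum.inl i) ↔ j ≠ i) ∧
    (Sum.inl j ∈ closedNbhd (crownGraph m) (Sum.inr i) ↔ j ≠ i) ∧
    (Sum.inr j ∈ closedNbhd (crownGraph m) (Sum.inr i) ↔ j = i) := by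
  simp [mem_closedNbhd, crownGraph, eq_comm]

lemma disjoint_closedNbhd_crownGraph {m : ℕ} (i : Fin m) :
    Disjoint (closedNbhd (crownGraph m) (Sum.inl i)) (closedNbhd (crownGraph m) (Sum.inr i)) := by
  rw [Set.disjoint_left]
  rintro (j | j) <;> simp [mem_closedNbhd_crownGraph]

/-- The sum of the unprimed coordinates minus the sum of the primed ones. Modulo `d`, it is the only
invariant of the row lattice of `Cr(2(d + 2))`. -/
def sideDiff (m : ℕ) : (Fin m ⊕ Fin m → ℤ) →ₗ[ℤ] ℤ :=
  ∑ i : Fin m, (LinearMap.proj (R := ℤ) (φ := fun _ => ℤ) (Sum.inl i) -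
    LinearMap.proj (R := ℤ) (φ := fun _ => ℤ) (Sum.inr i))

lemma sideDiff_apply {m : ℕ} (x : Fin m ⊕ Fin m → ℤ) :
    sideDiff m x = ∑ i, x (Sum.inl i) - ∑ i, x (Sum.inr i) := by
  simp [sideDiff]

lemma sideDiff_surjective {m : ℕ} [NeZero m] : Function.Surjective (sideDiff m) := fun c =>
  ⟨Pi.single (Sum.inl 0) c, by simp [sideDiff_apply, Pi.single_apply]⟩

lemma sum_ite_ne_and_ne {d : ℕ} (i j : Fin (d + 2)) :
    ∑ k, (if k ≠ i ∧ k ≠ j then 1 else 0 : ℤ) = d + ∑ k, if k = i ∧ k = j then 1 else 0 := by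
  have hsplit : ∀ k, (if k ≠ i ∧ k ≠ j then 1 else 0 : ℤ) =
      1 - (if k = i then 1 else 0) - (if k = j then 1 else 0) +
        if k = i ∧ k = j then 1 else 0 := fun k => by grind
  rw [Finset.sum_congr rfl fun k _ => hsplit k, Finset.sum_add_distrib, Finset.sum_sub_distrib,
    Finset.sum_sub_distrib]
  simp only [Finset.sum_const, Finset.card_univ, Fintype.card_fin, Finset.sum_ite_eq',
    Finset.mem_univ, if_true]
  ring

lemma sum_ite_eq_and_ne {m : ℕ} (i j : Fin m) :
    ∑ k, (if k = i ∧ k ≠ j then 1 else 0 : ℤ) = ∑ k, if k ≠ i ∧ k = j then 1 else 0 := by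
  have hdiff : ∀ k, ((if k = i ∧ k ≠ j then 1 else 0) - (if k ≠ i ∧ k = j then 1 else 0) : ℤ) =
      (if k = i then 1 else 0) - (if k = j then 1 else 0) := fun k => by grind
  rw [← sub_eq_zero, ← Finset.sum_sub_distrib, Finset.sum_congr rfl fun k _ => hdiff k,
    Finset.sum_sub_distrib, Finset.sum_ite_eq', Finset.sum_ite_eq']
  simp

lemma dvd_sideDiff_of_mem_rowLattice {d : ℕ} {x : Fin (d + 2) ⊕ Fin (d + 2) → ℤ}
    (hx : x ∈ rowLattice (crownGraph (d + 2))) : (d : ℤ) ∣ sideDiff (d + 2) x := by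
  have hle : rowLattice (crownGraph (d + 2)) ≤
      Submodule.comap (sideDiff (d + 2)) (Ideal.span {(d : ℤ)}) := rowLattice_le fun u v => by
    rw [Submodule.mem_comap, Ideal.mem_span_singleton, sideDiff_apply]
    rcases u with i | i <;> rcases v with j | j <;>
      simp only [bitVector_apply, Set.mem_inter_iff, mem_closedNbhd_crownGraph]
    · rw [sum_ite_ne_and_ne, sub_add_cancel_right, dvd_neg]
    · rw [sum_ite_eq_and_ne, sub_self]
      exact dvd_zero _
    · rw [sum_ite_eq_and_ne, sub_self]
      exact dvd_zero _
    · rw [sum_ite_ne_and_ne, add_sub_cancel_right]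
  exact Ideal.mem_span_singleton.1 (hle hx)

lemma single_add_single_mem_rowLattice_of_ne {m : ℕ} {i j : Fin m} (hij : i ≠ j) :
    Pi.single (Sum.inl i) 1 + Pi.single (Sum.inr j) 1 ∈ rowLattice (crownGraph m) := by
  convert bitVector_inter_mem_rowLattice (crownGraph m) (Sum.inl i) (Sum.inr j) using 1
  ext (k | k) <;>
    simp only [bitVector_apply, Set.mem_inter_iff, mem_closedNbhd_crownGraph, Pi.add_apply,
      Pi.single_apply, Sum.inl.injEq, Sum.inr.injEq, reduceCtorEq] <;>
    grind

lemma single_add_single_mem_rowLattice {m : ℕ} (hm : 3 ≤ m) (i j : Fin m) :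
    Pi.single (Sum.inl i) 1 + Pi.single (Sum.inr j) 1 ∈ rowLattice (crownGraph m) := by
  rcases eq_or_ne i j with rfl | hij
  · obtain ⟨j, hji, -⟩ := Fin.exists_ne_and_ne_of_two_lt i i hm
    obtain ⟨k, hki, hkj⟩ := Fin.exists_ne_and_ne_of_two_lt i j hm
    convert sub_mem (add_mem (single_add_single_mem_rowLattice_of_ne hji.symm)
      (single_add_single_mem_rowLattice_of_ne hki))
      (single_add_single_mem_rowLattice_of_ne hkj) using 1
    abel
  · exact single_add_single_mem_rowLattice_of_ne hij

lemma bitVector_closedNbhd_crownGraph_inl {m : ℕ} (i : Fin m) :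
    bitVector (closedNbhd (crownGraph m) (Sum.inl i)) =
      Pi.single (Sum.inl i) 1 + ∑ j ∈ Finset.univ.erase i, Pi.single (Sum.inr j) 1 := by
  ext (k | k)
  · simp [bitVector_apply, mem_closedNbhd_crownGraph, Pi.single_apply]
  · by_cases hk : k = i <;> simp [bitVector_apply, mem_closedNbhd_crownGraph, Pi.single_apply, hk]

lemma smul_single_mem_rowLattice {d : ℕ} (i : Fin (d + 2)) :
    (d : ℤ) • Pi.single (Sum.inl i) 1 ∈ rowLattice (crownGraph (d + 2)) := by
  have hsum := sum_mem fun j (hj : j ∈ Finset.univ.erase i) =>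
    single_add_single_mem_rowLattice_of_ne (Finset.ne_of_mem_erase hj).symm
  convert sub_mem hsum
    (bitVector_closedNbhd_mem_rowLattice (crownGraph (d + 2)) (Sum.inl i)) using 1
  rw [bitVector_closedNbhd_crownGraph_inl, Finset.sum_add_distrib, Finset.sum_const,
    Finset.card_erase_of_mem (Finset.mem_univ i), Finset.card_univ, Fintype.card_fin,
    Nat.add_succ_sub_one, succ_nsmul, natCast_zsmul]
  abel

lemma eq_sum_single_add_single {m : ℕ} (i₀ : Fin m) (x : Fin m ⊕ Fin m → ℤ) :
    x = ∑ i, x (Sum.inl i) • (Pi.single (Sum.inl i) 1 + Pi.single (Sum.inr i₀) 1) +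
      ∑ i, x (Sum.inr i) • (Pi.single (Sum.inl i₀) 1 + Pi.single (Sum.inr i) 1) -
      (∑ i, x (Sum.inl i)) • (Pi.single (Sum.inl i₀) 1 + Pi.single (Sum.inr i₀) 1) +
      sideDiff m x • Pi.single (Sum.inl i₀) 1 := by
  have hx : x = ∑ i, x (Sum.inl i) • Pi.single (Sum.inl i) 1 +
      ∑ i, x (Sum.inr i) • Pi.single (Sum.inr i) 1 := by
    ext (k | k) <;> simp [Pi.single_apply]
  rw [sideDiff_apply]
  simp only [smul_add, Finset.sum_add_distrib, sub_smul, ← Finset.sum_smul]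
  nth_rewrite 1 [hx]
  abel

lemma mem_rowLattice_crownGraph {d : ℕ} (hd : 1 ≤ d) {x : Fin (d + 2) ⊕ Fin (d + 2) → ℤ} :
    x ∈ rowLattice (crownGraph (d + 2)) ↔ (d : ℤ) ∣ sideDiff (d + 2) x := by
  refine ⟨dvd_sideDiff_of_mem_rowLattice, fun ⟨c, hc⟩ => ?_⟩
  have hpair := single_add_single_mem_rowLattice (Nat.add_le_add_right hd 2)
  rw [eq_sum_single_add_single 0 x, hc, mul_comm, mul_smul]
  exact add_mem (sub_mem (add_mem
    (sum_mem fun i _ => Submodule.smul_mem _ _ (hpair i 0))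
    (sum_mem fun i _ => Submodule.smul_mem _ _ (hpair 0 i)))
    (Submodule.smul_mem _ _ (hpair 0 0)))
    (Submodule.smul_mem _ _ (smul_single_mem_rowLattice 0))

lemma hasDiagonalForm_rowLattice_crownGraph {d : ℕ} (hd : 1 ≤ d) :
    HasDiagonalForm (rowLattice (crownGraph (d + 2))) fun _ : Unit => d :=
  ⟨(LinearEquiv.funUnique Unit ℤ ℤ).symm.toLinearMap ∘ₗ sideDiff (d + 2),
    (LinearEquiv.funUnique Unit ℤ ℤ).symm.surjective.comp sideDiff_surjective,
    fun _ => (mem_rowLattice_crownGraph hd).trans ⟨fun h _ => h, fun h => h ()⟩⟩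

lemma one_mem_rowLattice_crownGraph {d : ℕ} (hd : 1 ≤ d) :
    1 ∈ rowLattice (crownGraph (d + 2)) := by
  rw [mem_rowLattice_crownGraph hd, sideDiff_apply]
  simp

variable {n : ℕ} {d : Fin n → ℕ}

lemma surjective_pi_funLeft_sigmaMk {R ι : Type*} {V : ι → Type*} [Semiring R] :
    Function.Surjective (LinearMap.pi fun i => LinearMap.funLeft R R (Sigma.mk (β := V) i)) :=
  fun x => ⟨fun v => x v.1 v.2, rfl⟩

lemma hasDiagonalForm_rowLattice_crowns (hd : ∀ i, 1 ≤ d i) :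
    HasDiagonalForm (rowLattice (disjointUnion fun i => crownGraph (d i + 2))) d := by
  rw [rowLattice_disjointUnion]
  exact (HasDiagonalForm.iInf_comap (fun i => hasDiagonalForm_rowLattice_crownGraph (hd i))
    surjective_pi_funLeft_sigmaMk).reindex (Equiv.sigmaPUnit (Fin n)).symm

lemma one_mem_rowLattice_crowns (hd : ∀ i, 1 ≤ d i) :
    1 ∈ rowLattice (disjointUnion fun i => crownGraph (d i + 2)) := by
  rw [rowLattice_disjointUnion, Submodule.mem_iInf]
  exact fun i => one_mem_rowLattice_crownGraph (hd i)

lemma disjoint_closedNbhd_crowns (i : Fin n) :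
    Disjoint (closedNbhd (disjointUnion fun i => crownGraph (d i + 2)) ⟨i, Sum.inl 0⟩)
      (closedNbhd (disjointUnion fun i => crownGraph (d i + 2)) ⟨i, Sum.inr 0⟩) := by
  rw [closedNbhd_disjointUnion, closedNbhd_disjointUnion, Set.disjoint_image_iff sigma_mk_injective]
  exact disjoint_closedNbhd_crownGraph 0

end Crown

section Binary

/-- The numbers below `N` whose set of binary digits `1` contains that of `s`. -/
def supermasks (N s : ℕ) : Set (Fin N) :=
  {t | s &&& t = s}

/-- The binary expansion of `s` contains at most two ones; the case `b = c` is a single one. -/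
def AtMostTwoBits (s : ℕ) : Prop :=
  s = 0 ∨ ∃ b c : ℕ, s = 2 ^ b ||| 2 ^ c

variable {N : ℕ}

lemma mem_supermasks {s : ℕ} {t : Fin N} : t ∈ supermasks N s ↔ s &&& t = s :=
  Iff.rfl

lemma supermasks_zero : supermasks N 0 = Set.univ :=
  Set.eq_univ_of_forall fun t => Nat.zero_and t

lemma mem_supermasks_two_pow {b : ℕ} {t : Fin N} :
    t ∈ supermasks N (2 ^ b) ↔ (t : ℕ).testBit b = true := by
  rw [mem_supermasks, Nat.two_pow_and]
  cases (t : ℕ).testBit b <;> simp [(Nat.two_pow_pos b).ne]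

lemma supermasks_or (s t : ℕ) : supermasks N (s ||| t) = supermasks N s ∩ supermasks N t := by
  ext k
  simp only [Set.mem_inter_iff, mem_supermasks, Nat.eq_iff_testBit_eq, Nat.testBit_and,
    Nat.testBit_or, ← forall_and]
  exact forall_congr' fun i => by grind

lemma le_of_mem_supermasks {s : ℕ} {t : Fin N} (ht : t ∈ supermasks N s) : s ≤ t :=
  ht.symm.trans_le Nat.and_le_right

lemma supermasks_of_le {s : ℕ} (h : N ≤ s) : supermasks N s = ∅ :=
  Set.eq_empty_of_forall_notMem fun t ht => (t.2.trans_le h).not_ge (le_of_mem_supermasks ht)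

lemma det_bitVector_supermasks :
    (Matrix.of fun s : Fin N => bitVector (supermasks N s)).det = 1 := by
  rw [det_of_isUpperTriangular fun s t hts => ?_]
  · simp [bitVector_apply, mem_supermasks]
  · exact Set.indicator_of_notMem (fun h => hts.not_ge (le_of_mem_supermasks h)) 1

lemma exists_basis_eq_bitVector_supermasks (N : ℕ) :
    ∃ b : Basis (Fin N) ℤ (Fin N → ℤ), ∀ s : Fin N, b s = bitVector (supermasks N s) := by
  obtain ⟨hli, hspan⟩ := ((Pi.basisFun ℤ (Fin N)).is_basis_iff_det
    (v := fun s => bitVector (supermasks N s))).2 <| by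
      rw [Pi.basisFun_det]
      exact Int.isUnit_iff.2 (Or.inl det_bitVector_supermasks)
  exact ⟨Basis.mk hli hspan.ge, fun s => Basis.mk_apply hli hspan.ge s⟩

lemma inl_mem_closedNbhd_binaryGraph_inl (k l : Fin N) :
    Sum.inl l ∈ closedNbhd (binaryGraph N) (Sum.inl k) :=
  (eq_or_ne l k).imp (congrArg _) Ne.symm

lemma inr_mem_closedNbhd_binaryGraph_inr (i j : Fin (Nat.clog 2 N)) :
    Sum.inr j ∈ closedNbhd (binaryGraph N) (Sum.inr i) :=
  (eq_or_ne j i).imp (congrArg _) Ne.symm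

lemma inr_mem_closedNbhd_binaryGraph_inl {k : Fin N} {i : Fin (Nat.clog 2 N)} :
    Sum.inr i ∈ closedNbhd (binaryGraph N) (Sum.inl k) ↔ (k : ℕ).testBit i = true := by
  simp [mem_closedNbhd, binaryGraph]

lemma preimage_inl_closedNbhd_binaryGraph_inl (k : Fin N) :
    Sum.inl ⁻¹' closedNbhd (binaryGraph N) (Sum.inl k) = supermasks N 0 := by
  rw [supermasks_zero]
  exact Set.eq_univ_of_forall (inl_mem_closedNbhd_binaryGraph_inl k)

lemma preimage_inl_closedNbhd_binaryGraph_inr (i : Fin (Nat.clog 2 N)) :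
    Sum.inl ⁻¹' closedNbhd (binaryGraph N) (Sum.inr i) = supermasks N (2 ^ (i : ℕ)) := by
  ext t
  rw [Set.mem_preimage, mem_closedNbhd_comm, inr_mem_closedNbhd_binaryGraph_inl,
    mem_supermasks_two_pow]

lemma single_inr_mem_rowLattice_binaryGraph (i : Fin (Nat.clog 2 N)) :
    Pi.single (Sum.inr i) 1 ∈ rowLattice (binaryGraph N) := by
  have hi : 2 ^ (i : ℕ) < N := (Nat.lt_clog_iff_pow_lt one_lt_two).1 i.2
  convert sub_mem
    (bitVector_closedNbhd_mem_rowLattice (binaryGraph N) (Sum.inl ⟨2 ^ (i : ℕ), hi⟩))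
    (bitVector_closedNbhd_mem_rowLattice (binaryGraph N) (Sum.inl ⟨0, hi.pos⟩)) using 1
  ext (t | j)
  · simp [bitVector_apply, inl_mem_closedNbhd_binaryGraph_inl]
  · simp [bitVector_apply, inr_mem_closedNbhd_binaryGraph_inl, Pi.single_apply,
      Nat.testBit_two_pow, Fin.ext_iff, eq_comm]

lemma exists_preimage_inl_inter_eq_supermasks (u v : Fin N ⊕ Fin (Nat.clog 2 N)) :
    ∃ s, AtMostTwoBits s ∧ Sum.inl ⁻¹'
      (closedNbhd (binaryGraph N) u ∩ closedNbhd (binaryGraph N) v) = supermasks N s := by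
  rcases u with k | i <;> rcases v with l | j <;>
    simp only [Set.preimage_inter, preimage_inl_closedNbhd_binaryGraph_inl,
      preimage_inl_closedNbhd_binaryGraph_inr, ← supermasks_or]
  · exact ⟨_, Or.inl (Nat.or_self 0), rfl⟩
  · exact ⟨_, Or.inr ⟨j, j, by simp⟩, rfl⟩
  · exact ⟨_, Or.inr ⟨i, i, by simp⟩, rfl⟩
  · exact ⟨_, Or.inr ⟨i, j, rfl⟩, rfl⟩

lemma exists_supermasks_eq_preimage_inl_inter {s : ℕ} (hs : AtMostTwoBits s) (hsN : s < N) :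
    ∃ u v, Sum.inl ⁻¹' (closedNbhd (binaryGraph N) u ∩ closedNbhd (binaryGraph N) v) =
      supermasks N s := by
  rcases hs with rfl | ⟨b, c, rfl⟩
  · refine ⟨Sum.inl ⟨0, hsN⟩, Sum.inl ⟨0, hsN⟩, ?_⟩
    rw [Set.inter_self, preimage_inl_closedNbhd_binaryGraph_inl]
  · have hlt : ∀ {a}, 2 ^ a ≤ 2 ^ b ||| 2 ^ c → a < Nat.clog 2 N := fun ha =>
      (Nat.lt_clog_iff_pow_lt one_lt_two).2 (ha.trans_lt hsN)
    refine ⟨Sum.inr ⟨b, hlt Nat.left_le_or⟩, Sum.inr ⟨c, hlt Nat.right_le_or⟩, ?_⟩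
    rw [Set.preimage_inter, preimage_inl_closedNbhd_binaryGraph_inr,
      preimage_inl_closedNbhd_binaryGraph_inr, supermasks_or]

lemma rowLattice_binaryGraph {b : Fin N → Fin N → ℤ}
    (hb : ∀ s : Fin N, b s = bitVector (supermasks N s)) :
    rowLattice (binaryGraph N) = (Submodule.span ℤ (b '' {s | AtMostTwoBits s})).comap
      (LinearMap.funLeft ℤ ℤ Sum.inl) := by
  rw [comap_funLeft_rowLattice (f := Sum.inl)]
  · congr 1
    refine le_antisymm (Submodule.span_le.2 ?_) (Submodule.span_le.2 ?_)
    · rintro _ ⟨⟨u, v⟩, rfl⟩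
      obtain ⟨s, hs, huv⟩ := exists_preimage_inl_inter_eq_supermasks u v
      simp only [huv]
      rcases lt_or_ge s N with hsN | hsN
      · exact Submodule.subset_span ⟨⟨s, hsN⟩, hs, hb _⟩
      · rw [supermasks_of_le hsN, bitVector, Set.indicator_empty]
        exact zero_mem _
    · rintro _ ⟨s, hs, rfl⟩
      obtain ⟨u, v, huv⟩ := exists_supermasks_eq_preimage_inl_inter hs s.2
      exact Submodule.subset_span ⟨(u, v), by rw [hb, ← huv]⟩
  · rintro (k | i) h
    · exact absurd ⟨k, rfl⟩ h
    · exact single_inr_mem_rowLattice_binaryGraph i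

lemma hasDiagonalForm_rowLattice_binaryGraph (N : ℕ) :
    HasDiagonalForm (rowLattice (binaryGraph N))
      fun _ : ↥{s : Fin N | AtMostTwoBits s}ᶜ => 0 := by
  obtain ⟨b, hb⟩ := exists_basis_eq_bitVector_supermasks N
  rw [rowLattice_binaryGraph hb]
  exact (hasDiagonalForm_span_basis_image b _).comap
    (LinearMap.funLeft_surjective_of_injective ℤ ℤ _ Sum.inl_injective)

lemma one_mem_rowLattice_binaryGraph (hN : 1 ≤ N) : 1 ∈ rowLattice (binaryGraph N) := by
  obtain ⟨b, hb⟩ := exists_basis_eq_bitVector_supermasks N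
  rw [rowLattice_binaryGraph hb]
  refine Submodule.subset_span ⟨⟨0, hN⟩, Or.inl rfl, ?_⟩
  rw [hb, supermasks_zero, bitVector, Set.indicator_univ]
  rfl

lemma binaryGraph_connected (hN : 2 ≤ N) : (binaryGraph N).Connected := by
  have hbit : (binaryGraph N).Adj (Sum.inl ⟨1, hN⟩)
      (Sum.inr ⟨0, Nat.clog_pos one_lt_two hN⟩) := by
    simp [binaryGraph]
  refine (SimpleGraph.connected_iff_exists_forall_reachable _).2 ⟨Sum.inl ⟨1, hN⟩, ?_⟩
  rintro (k | i)
  · rcases inl_mem_closedNbhd_binaryGraph_inl ⟨1, hN⟩ k with h | h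
    · rw [h]
    · exact SimpleGraph.Adj.reachable h
  · rcases inr_mem_closedNbhd_binaryGraph_inr ⟨0, Nat.clog_pos one_lt_two hN⟩ i with h | h
    · rw [h]
      exact hbit.reachable
    · exact hbit.reachable.trans (SimpleGraph.Adj.reachable h)

lemma not_atMostTwoBits (j : ℕ) : ¬ AtMostTwoBits (8 * j + 7) := by
  have hbit : ∀ i < 3, (8 * j + 7).testBit i = true := fun i hi => by
    interval_cases i <;> simp [Nat.testBit_succ] <;> lia
  rintro (h | ⟨b, c, h⟩)
  · lia
  · simp only [h, Nat.testBit_or, Nat.testBit_two_pow, Bool.or_eq_true, decide_eq_true_eq] at hbit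
    have h0 := hbit 0
    have h1 := hbit 1
    have h2 := hbit 2
    lia

lemma infinite_not_atMostTwoBits : {k | ¬ AtMostTwoBits k}.Infinite :=
  Set.infinite_of_injective_forall_mem (f := fun j : ℕ => 8 * j + 7)
    (fun _ _ h => by simpa using h) not_atMostTwoBits

lemma binaryNullity_eq_card (N : ℕ) :
    binaryNullity N = Nat.card ↥{s : Fin N | AtMostTwoBits s}ᶜ :=
  ((hasDiagonalForm_rowLattice_binaryGraph N).emptySum Empty.elim).nullity_eq nofun

open Classical in
lemma binaryNullity_eq_count (N : ℕ) :
    binaryNullity N = Nat.count (fun k => ¬ AtMostTwoBits k) N := by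
  let _ := Nat.CountSet.fintype (fun k => ¬ AtMostTwoBits k) N
  rw [binaryNullity_eq_card, Nat.count_eq_card_fintype, ← Nat.card_eq_fintype_card]
  exact Nat.card_congr ((Fin.equivSubtype.subtypeEquiv fun _ => Iff.rfl).trans
    (Equiv.subtypeSubtypeEquivSubtypeInter (· < N) fun k => ¬ AtMostTwoBits k))

lemma exists_binaryNullity_eq (r : ℕ) : ∃ N, 2 ≤ N ∧ binaryNullity N = r := by
  classical
  have hinf := infinite_not_atMostTwoBits
  refine ⟨Nat.nth (fun k => ¬ AtMostTwoBits k) r, ?_, ?_⟩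
  · have hr : ¬ AtMostTwoBits _ := Nat.nth_mem_of_infinite hinf r
    contrapose! hr
    interval_cases Nat.nth (fun k => ¬ AtMostTwoBits k) r
    · exact Or.inl rfl
    · exact Or.inr ⟨0, 0, rfl⟩
  · rw [binaryNullity_eq_count, Nat.count_nth_of_infinite hinf]

end Binary

section Realization

variable {n : ℕ} {d : Fin n → ℕ}

lemma nullity_eq_and_hasNontrivialNonzeroElementaryDivisors {V κ : Type} [Fintype V]
    [DecidableEq V] [Finite κ] {Γ : SimpleGraph V}
    (hΓ : HasDiagonalForm (rowLattice Γ) (Sum.elim d fun _ : κ => 0)) (hd : ∀ i, 2 ≤ d i)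
    (hdvd : ∀ i j, i ≤ j → d i ∣ d j) :
    nullity (raMatrix Γ) = Nat.card κ ∧
      HasNontrivialNonzeroElementaryDivisors (raMatrix Γ) (List.ofFn d) :=
  ⟨hΓ.nullity_eq fun i => (two_pos.trans_le (hd i)).ne',
    hΓ.hasNontrivialNonzeroElementaryDivisors
      (Fintype.card_le_of_injective _ Sum.inl_injective) hd hdvd⟩

lemma hasDiagonalForm_rowLattice_pyramid_crowns (hn : 0 < n) (hd : ∀ i, 1 ≤ d i) :
    HasDiagonalForm
      (rowLattice (pyramid (disjointUnion fun i => crownGraph (d i + 2)))) d := by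
  rw [rowLattice_pyramid (one_mem_rowLattice_crowns hd) (disjoint_closedNbhd_crowns ⟨0, hn⟩)]
  exact (hasDiagonalForm_rowLattice_crowns hd).comap
    (LinearMap.funLeft_surjective_of_injective ℤ ℤ _ Sum.inr_injective)

lemma one_mem_rowLattice_sum {V W : Type} {G : SimpleGraph V} {H : SimpleGraph W}
    (hG : 1 ∈ rowLattice G) (hH : 1 ∈ rowLattice H) : 1 ∈ rowLattice (G ⊕g H) := by
  rw [rowLattice_sum]
  exact ⟨hG, hH⟩

lemma hasDiagonalForm_rowLattice_sum {V W : Type} {ι κ : Type*} {G : SimpleGraph V}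
    {H : SimpleGraph W} {a : ι → ℕ} {b : κ → ℕ} (hG : HasDiagonalForm (rowLattice G) a)
    (hH : HasDiagonalForm (rowLattice H) b) :
    HasDiagonalForm (rowLattice (G ⊕g H)) (Sum.elim a b) := by
  rw [rowLattice_sum]
  exact hG.inf_comap hH fun x => ⟨Sum.elim x.1 x.2, rfl⟩

lemma hasDiagonalForm_rowLattice_pyramid_crowns_sum_binaryGraph (hn : 0 < n)
    (hd : ∀ i, 1 ≤ d i) {N : ℕ} (hN : 1 ≤ N) :
    HasDiagonalForm
      (rowLattice (pyramid ((disjointUnion fun i => crownGraph (d i + 2)) ⊕g binaryGraph N)))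
      (Sum.elim d fun _ : ↥{s : Fin N | AtMostTwoBits s}ᶜ => 0) := by
  have hdisj := disjoint_closedNbhd_crowns (d := d) ⟨0, hn⟩
  rw [← Set.disjoint_image_iff Sum.inl_injective, ← closedNbhd_sum_inl _ (binaryGraph N),
    ← closedNbhd_sum_inl _ (binaryGraph N)] at hdisj
  rw [rowLattice_pyramid (one_mem_rowLattice_sum (one_mem_rowLattice_crowns hd)
    (one_mem_rowLattice_binaryGraph hN)) hdisj]
  exact (hasDiagonalForm_rowLattice_sum (hasDiagonalForm_rowLattice_crowns hd)
    (hasDiagonalForm_rowLattice_binaryGraph N)).comap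
    (LinearMap.funLeft_surjective_of_injective ℤ ℤ _ Sum.inr_injective)

end Realization

end RAGraph

theorem mainTheorem1 (n : ℕ) (d : Fin n → ℕ) (hd : ∀ i, 2 ≤ d i)
    (hdvd : ∀ i j : Fin n, i ≤ j → d i ∣ d j) (r : ℕ) :
    -- there is a (finite, connected) graph with the prescribed nullity and elementary divisors
    (∃ (V : Type) (_ : Fintype V) (_ : DecidableEq V) (Γ : SimpleGraph V), Γ.Connected ∧
      RAGraph.nullity (RAGraph.raMatrix Γ) = r ∧
      RAGraph.HasNontrivialNonzeroElementaryDivisors (RAGraph.raMatrix Γ) (List.ofFn d)) ∧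
    -- the number `r` is the nullity of the RA matrix of some binary graph
    (∃ N : ℕ, 2 ≤ N ∧ RAGraph.binaryNullity N = r) ∧
    -- the pyramid over the crown graphs `Cr(2 d_i + 4)` and any such binary graph is such a graph
    (0 < n → ∀ N : ℕ, 2 ≤ N → RAGraph.binaryNullity N = r →
      RAGraph.nullity (RAGraph.raMatrix (RAGraph.pyramid
        (RAGraph.disjointUnion (fun i : Fin n => RAGraph.crownGraph (d i + 2)) ⊕g
          RAGraph.binaryGraph N))) = r ∧
      RAGraph.HasNontrivialNonzeroElementaryDivisors (RAGraph.raMatrix (RAGraph.pyramid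
        (RAGraph.disjointUnion (fun i : Fin n => RAGraph.crownGraph (d i + 2)) ⊕g
          RAGraph.binaryGraph N))) (List.ofFn d)) ∧
    -- for `r = 0` the binary graph may be left out
    (0 < n → r = 0 →
      RAGraph.nullity (RAGraph.raMatrix (RAGraph.pyramid
        (RAGraph.disjointUnion (fun i : Fin n => RAGraph.crownGraph (d i + 2))))) = 0 ∧
      RAGraph.HasNontrivialNonzeroElementaryDivisors (RAGraph.raMatrix (RAGraph.pyramid
        (RAGraph.disjointUnion (fun i : Fin n => RAGraph.crownGraph (d i + 2))))) (List.ofFn d)) := by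
  have hd' : ∀ i, 1 ≤ d i := fun i => one_le_two.trans (hd i)
  have hpyramid (hn : 0 < n) {N : ℕ} (hN : 2 ≤ N) :=
    RAGraph.nullity_eq_and_hasNontrivialNonzeroElementaryDivisors
      (RAGraph.hasDiagonalForm_rowLattice_pyramid_crowns_sum_binaryGraph hn hd'
        (one_le_two.trans hN)) hd hdvd
  simp only [← RAGraph.binaryNullity_eq_card] at hpyramid
  obtain ⟨N, hN, hr⟩ := RAGraph.exists_binaryNullity_eq r
  refine ⟨?_, ⟨N, hN, hr⟩, fun hn _ hN hr => (hpyramid hn hN).imp_left (·.trans hr), fun hn _ => ?_⟩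
  · rcases Nat.eq_zero_or_pos n with rfl | hn
    · exact ⟨_, inferInstance, inferInstance, RAGraph.binaryGraph N,
        RAGraph.binaryGraph_connected hN, hr,
        (RAGraph.nullity_eq_and_hasNontrivialNonzeroElementaryDivisors
          ((RAGraph.hasDiagonalForm_rowLattice_binaryGraph N).emptySum d) hd hdvd).2⟩
    · exact ⟨_, inferInstance, inferInstance, _, RAGraph.pyramid_connected _,
        (hpyramid hn hN).imp_left (·.trans hr)⟩
  · exact (RAGraph.nullity_eq_and_hasNontrivialNonzeroElementaryDivisors
      ((RAGraph.hasDiagonalForm_rowLattice_pyramid_crowns hn hd').sumEmpty fun _ : Empty => 0)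
      hd hdvd).imp_left (·.trans Nat.card_of_isEmpty)
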